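/- All graphs are finite and simple. For graphs $F$ and $G$, the categorical product $F\times G$, the OR-product $F\cdot G$ and the join $F\oplus G$ are defined as follows. The graphs $F\times G$ and $F\cdot G$ have vertex set $V(F)\times V(G)$; vertices $(f,g)$ and $(f',g')$ are adjacent in $F\times G$ if $\{f,f'\}\in E(F)$ and $\{g,g'\}\in E(G)$, and adjacent in $F\cdot G$ if $\{f,f'\}\in E(F)$ or $\{g,g'\}\in E(G)$. The join $F\oplus G$ is the disjoint union of $F$ and $G$ together with all edges between $V(F)$ and $V(G)$. Write $G^t$ for the $t$-fold OR-product of $G$ with itself, $\omega$ for the clique number, and $F\to G$ if there is a graph homomorphism from $F$ to $G$. The Shannon OR-capacity of $G$ is the (always existing) limit $C_{\rm OR}(G)=\lim_{t\to\infty}\sqrt[t]{\omega(G^t)}$. Let $S$ be a collection of graphs that contains the one-vertex graph $K_1$ and is closed under the join and the OR-product (for example, the collection of all graphs). The asymptotic spectrum $Y(S)$ is the set of all maps $\varphi:S\to\mathbb{R}_{\ge 0}$ such that for all $G,H\in S$: $\varphi(K_1)=1$; $\varphi(G\oplus H)=\varphi(G)+\varphi(H)$; $\varphi(G\cdot H)=\varphi(G)\,\varphi(H)$;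 and $\varphi(G)\le\varphi(H)$ whenever $G\to H$. Theorem. Let $F$ and $G$ be graphs such that $F$, $G$ and $F\times G$ belong to $S$. Then either $$C_{\rm OR}(F\times G)=\min\{C_{\rm OR}(F),C_{\rm OR}(G)\},$$ or there exists $\varphi\in Y(S)$ with $$\varphi(F\times G)<\min\{\varphi(F),\varphi(G)\}.$$ (The two alternatives are not claimed to be mutually exclusive.) -/

import Mathlib

open Filter Topology
open scoped NNReal

universe u

/-- A finite simple graph, with its vertex set. -/
structure FinGraph where
  /-- the vertex set -/
  V : Type u
  [finite : Finite V]
  /-- the adjacency relation -/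
  graph : SimpleGraph V

namespace FinGraph

attribute [instance] FinGraph.finite

/-- The single vertex graph `K₁`. -/
def K1 : FinGraph.{u} where
  V := PUnit.{u + 1}
  graph := ⊥

/-- The categorical (tensor, weak direct) product `F × G`: two pairs are adjacent if they are
adjacent in both coordinates. -/
def catProd (F G : FinGraph.{u}) : FinGraph.{u} where
  V := F.V × G.V
  graph :=
    { Adj := fun p q => F.graph.Adj p.1 q.1 ∧ G.graph.Adj p.2 q.2
      symm := ⟨fun _ _ h => ⟨h.1.symm, h.2.symm⟩⟩
      loopless := ⟨fun _ h => F.graph.irrefl h.1⟩ }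

/-- The OR-product `F · G`: two pairs are adjacent if they are adjacent in at least one
coordinate. -/
def orProd (F G : FinGraph.{u}) : FinGraph.{u} where
  V := F.V × G.V
  graph :=
    { Adj := fun p q => F.graph.Adj p.1 q.1 ∨ G.graph.Adj p.2 q.2
      symm := ⟨fun _ _ h => h.imp (fun h => h.symm) (fun h => h.symm)⟩
      loopless := ⟨fun _ h => h.elim F.graph.irrefl G.graph.irrefl⟩ }

/-- The join `F ⊕ G`: the disjoint union of `F` and `G`, with all the edges between a vertex of
`F` and a vertex of `G` added. -/
def join (F G : FinGraph.{u}) : FinGraph.{u} where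
  V := F.V ⊕ G.V
  graph :=
    { Adj := fun p q =>
        match p, q with
        | Sum.inl a, Sum.inl b => F.graph.Adj a b
        | Sum.inr a, Sum.inr b => G.graph.Adj a b
        | Sum.inl _, Sum.inr _ => True
        | Sum.inr _, Sum.inl _ => True
      symm := ⟨fun p q h => by
        cases p <;> cases q <;> first | exact trivial | exact SimpleGraph.Adj.symm h⟩
      loopless := ⟨fun p h => by
        cases p with
        | inl a => exact F.graph.irrefl h
        | inr a => exact G.graph.irrefl h⟩ }

/-- The `t`-fold OR-product `G ^ t` of `G` with itself: the vertices are the words of length `t`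
over the vertices of `G`, and two words are adjacent if they are adjacent in at least one
coordinate. -/
def orPow (G : FinGraph.{u}) (t : ℕ) : FinGraph.{u} where
  V := Fin t → G.V
  graph :=
    { Adj := fun x y => ∃ i, G.graph.Adj (x i) (y i)
      symm := ⟨fun _ _ ⟨i, h⟩ => ⟨i, h.symm⟩⟩
      loopless := ⟨fun _ ⟨_, h⟩ => G.graph.irrefl h⟩ }

/-- `F → G`: there is a graph homomorphism from `F` to `G`. -/
def HomTo (F G : FinGraph.{u}) : Prop :=
  Nonempty (F.graph →g G.graph)

/-- The sequence whose limit is the Shannon OR-capacity, the `t`-th root of the clique number of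
the `t`-fold OR-product `G ^ t`. -/
noncomputable def orRate (G : FinGraph.{u}) (t : ℕ) : ℝ :=
  ((G.orPow t).graph.cliqueNum : ℝ) ^ (1 / (t : ℝ))

/-- The Shannon OR-capacity of `G`, the limit of the `t`-th roots of the clique numbers of
the `t`-fold OR-products `G ^ t`. The limit always exists: see `FinGraph.tendsto_orRate`. -/
noncomputable def shannonOR (G : FinGraph.{u}) : ℝ :=
  limUnder atTop G.orRate

/-- `G ^ (t + 1)` is the OR-product of `G` with `G ^ t`. -/
theorem orPow_succ_iso (G : FinGraph.{u}) (t : ℕ) :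
    Nonempty ((G.orPow (t + 1)).graph ≃g (G.orProd (G.orPow t)).graph) := by
  refine ⟨(Fin.consEquiv fun _ : Fin (t + 1) => G.V).symm, ?_⟩
  intro x y
  exact (Fin.exists_fin_succ (P := fun i => G.graph.Adj (x i) (y i))).symm

theorem cliqueNum_orPow_mul_le (G : FinGraph.{u}) (s t : ℕ) :
    (G.orPow s).graph.cliqueNum * (G.orPow t).graph.cliqueNum ≤
      (G.orPow (s + t)).graph.cliqueNum := by
  obtain ⟨A, hA⟩ := (G.orPow s).graph.exists_isNClique_cliqueNum
  obtain ⟨B, hB⟩ := (G.orPow t).graph.exists_isNClique_cliqueNum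
  let e : (G.orPow s).V × (G.orPow t).V ↪ (G.orPow (s + t)).V :=
    (Fin.appendEquiv (α := G.V) s t).toEmbedding
  rw [← hA.card_eq, ← hB.card_eq, ← Finset.card_product, ← Finset.card_map e]
  refine SimpleGraph.IsClique.card_le_cliqueNum (G := (G.orPow (s + t)).graph) (tc := ?_)
  intro x hx y hy hxy
  obtain ⟨⟨a, b⟩, hab, rfl⟩ := Finset.mem_map.1 (Finset.mem_coe.1 hx)
  obtain ⟨⟨a', b'⟩, hab', rfl⟩ := Finset.mem_map.1 (Finset.mem_coe.1 hy)
  obtain ⟨ha, hb⟩ := Finset.mem_product.1 hab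
  obtain ⟨ha', hb'⟩ := Finset.mem_product.1 hab'
  by_cases h : a = a'
  · subst h
    have hne : b ≠ b' := fun h => hxy (by rw [h])
    obtain ⟨i, hi⟩ := hB.isClique hb hb' hne
    refine ⟨Fin.natAdd s i, ?_⟩
    exact (congrArg₂ G.graph.Adj (Fin.append_right a b i) (Fin.append_right a b' i)).mpr hi
  · obtain ⟨i, hi⟩ := hA.isClique ha ha' h
    refine ⟨Fin.castAdd t i, ?_⟩
    exact (congrArg₂ G.graph.Adj (Fin.append_left a b i) (Fin.append_left a' b' i)).mpr hi

theorem cliqueNum_orPow_pos (G : FinGraph.{u}) [Nonempty G.V] (t : ℕ) :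
    0 < (G.orPow t).graph.cliqueNum := by
  have : Nonempty (G.orPow t).V := inferInstanceAs (Nonempty (Fin t → G.V))
  obtain ⟨x⟩ := this
  have h := SimpleGraph.IsClique.card_le_cliqueNum (G := (G.orPow t).graph) (t := {x})
    (tc := by simp)
  rwa [Finset.card_singleton] at h

theorem cliqueNum_orPow_le (G : FinGraph.{u}) (t : ℕ) :
    (G.orPow t).graph.cliqueNum ≤ Nat.card G.V ^ t := by
  have := Fintype.ofFinite (G.orPow t).V
  obtain ⟨A, hA⟩ := (G.orPow t).graph.exists_isNClique_cliqueNum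
  have h1 : Nat.card (G.orPow t).V = Nat.card G.V ^ t := by
    change Nat.card (Fin t → G.V) = _
    simp [Nat.card_fun]
  rw [← hA.card_eq, ← h1, Nat.card_eq_fintype_card]
  exact Finset.card_le_univ A

/-- The limit in the definition of the Shannon OR-capacity exists. -/
theorem tendsto_orRate (G : FinGraph.{u}) : Tendsto G.orRate atTop (𝓝 G.shannonOR) := by
  refine tendsto_nhds_limUnder ?_
  rcases isEmpty_or_nonempty G.V with hG | hG
  · refine ⟨0, tendsto_const_nhds.congr' ?_⟩
    filter_upwards [eventually_gt_atTop 0] with t ht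
    have h : (G.orPow t).graph.cliqueNum = 0 := by
      have := G.cliqueNum_orPow_le t
      simpa [ht.ne'] using this
    rw [orRate, h, Nat.cast_zero, Real.zero_rpow]
    have : (0 : ℝ) < t := by exact_mod_cast ht
    positivity
  · have hpos : ∀ t, (0 : ℝ) < (G.orPow t).graph.cliqueNum := fun t => by
      exact_mod_cast G.cliqueNum_orPow_pos t
    have hsub : Subadditive fun t => -Real.log (G.orPow t).graph.cliqueNum := by
      intro m n
      have h : ((G.orPow m).graph.cliqueNum : ℝ) * (G.orPow n).graph.cliqueNum ≤
          (G.orPow (m + n)).graph.cliqueNum := by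
        exact_mod_cast G.cliqueNum_orPow_mul_le m n
      have h2 := Real.log_le_log (mul_pos (hpos m) (hpos n)) h
      rw [Real.log_mul (hpos m).ne' (hpos n).ne'] at h2
      linarith
    have hbdd : BddBelow
        (Set.range fun t : ℕ => -Real.log (G.orPow t).graph.cliqueNum / (t : ℝ)) := by
      refine ⟨-Real.log (Nat.card G.V), ?_⟩
      rintro _ ⟨t, rfl⟩
      have hc : (1 : ℝ) ≤ Nat.card G.V := by exact_mod_cast Nat.card_pos (α := G.V)
      rcases Nat.eq_zero_or_pos t with rfl | ht
      · simpa using Real.log_nonneg hc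
      · have ht' : (0 : ℝ) < t := by exact_mod_cast ht
        have h : ((G.orPow t).graph.cliqueNum : ℝ) ≤ (Nat.card G.V : ℝ) ^ t := by
          exact_mod_cast G.cliqueNum_orPow_le t
        have h2 := Real.log_le_log (hpos t) h
        rw [Real.log_pow] at h2
        change _ ≤ -Real.log (G.orPow t).graph.cliqueNum / (t : ℝ)
        rw [le_div_iff₀ ht']
        linarith
    have hlim := (hsub.tendsto_lim hbdd).neg
    refine ⟨_, ((Real.continuous_exp.tendsto _).comp hlim).congr fun t => ?_⟩
    rw [orRate, Real.rpow_def_of_pos (hpos t), Function.comp_apply]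
    congr 1
    ring

/-- `S` is closed under the join and the OR-product, and contains `K₁`. -/
structure IsClosedFamily (S : Set FinGraph.{u}) : Prop where
  K1_mem : K1 ∈ S
  join_mem : ∀ {G H : FinGraph.{u}}, G ∈ S → H ∈ S → G.join H ∈ S
  orProd_mem : ∀ {G H : FinGraph.{u}}, G ∈ S → H ∈ S → G.orProd H ∈ S

/-- The collection of all finite simple graphs is such a family. -/
theorem isClosedFamily_univ : IsClosedFamily (Set.univ : Set FinGraph.{u}) :=
  ⟨trivial, fun _ _ => trivial, fun _ _ => trivial⟩

/-- The asymptotic spectrum `Y(S)` of `S`: the maps `φ : S → ℝ≥0` that are normalized at `K₁`,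
additive under the join, multiplicative under the OR-product, and monotone along
homomorphisms. -/
def asymptoticSpectrum {S : Set FinGraph.{u}} (hS : IsClosedFamily S) : Set (S → ℝ≥0) :=
  { φ | φ ⟨K1, hS.K1_mem⟩ = 1 ∧
      (∀ G H : S, φ ⟨G.1.join H.1, hS.join_mem G.2 H.2⟩ = φ G + φ H) ∧
      (∀ G H : S, φ ⟨G.1.orProd H.1, hS.orProd_mem G.2 H.2⟩ = φ G * φ H) ∧
      (∀ G H : S, G.1.HomTo H.1 → φ G ≤ φ H) }

end FinGraph

/-! Both projections of `F.catProd G` are homomorphisms, so its capacity is at most the minimum of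
the two capacities. If it is strictly smaller, it suffices to find a point φ of the spectrum with
φ(F × G) < min{C(F), C(G)}: every point bounds the capacity from above, because ω(G^t) ≤ φ(G)^t, so
the right side is at most min{φ(F), φ(G)}. This is `shannonOR_le_orderRingHom` together with
`exists_orderRingHom_lt`, the hard direction of Strassen duality.

For the latter, graphs up to homomorphic equivalence form an ordered commutative semiring (join,
OR-product) in which n is the class of the complete graph on n vertices, every element lies below
some natural number, and every nonzero element is at least 1. Let h be the class of a nonempty graph
H, and let p/q exceed C(H). If p ≤ q h followed by cancelling a summand and a nonzero factor, then
taking powers and clique numbers would give p ≤ q C(H). Hence q h ≤ p can be added to the order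
without making any m + 1 lie below m. Zorn's lemma extends the result to a total preorder, and
comparing multiples with natural numbers there, as in a Dedekind cut, yields a real homomorphism
with q φ(h) ≤ p.

The point is built on all graphs and only then restricted to S. -/

/-! ### Strassen preorders and their total extensions -/

section Strassen

variable {R : Type*} [CommSemiring R] [PartialOrder R]

/-- A preorder on an ordered semiring that extends the given order, is compatible with addition and
multiplication, and keeps `m + 1` from being below `m` for all natural numbers `m`. -/
structure IsStrassenPreorder (r : R → R → Prop) : Prop where
  of_le : ∀ {a b}, a ≤ b → r a b
  trans : ∀ {a b c}, r a b → r b c → r a c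
  add_right : ∀ {a b}, r a b → ∀ c, r (a + c) (b + c)
  mul_left : ∀ {a b}, r a b → ∀ c, r (c * a) (c * b)
  not_succ_le : ∀ m : ℕ, ¬ r (m + 1) m

/-- The relation obtained from `r` by cancelling summands and nonzero factors. -/
def cancelClosure (r : R → R → Prop) (x y : R) : Prop :=
  ∃ s z, s ≠ 0 ∧ r (s * x + z) (s * y + z)

/-- The relation obtained from `r` by forcing `a` to be below `b`. -/
def adjoinLE (r : R → R → Prop) (a b x y : R) : Prop :=
  ∃ s, r (x + s * b) (y + s * a)

namespace IsStrassenPreorder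

variable {r : R → R → Prop}

theorem add (h : IsStrassenPreorder r) {a b c d : R} (hab : r a b) (hcd : r c d) :
    r (a + c) (b + d) := by
  refine h.trans (h.add_right hab c) ?_
  rw [add_comm b c, add_comm b d]
  exact h.add_right hcd b

theorem mul (h : IsStrassenPreorder r) {a b c d : R} (hab : r a b) (hcd : r c d) :
    r (a * c) (b * d) := by
  refine h.trans (h.mul_left hcd a) ?_
  rw [mul_comm a d, mul_comm b d]
  exact h.mul_left hab d

theorem natCast_le (h : IsStrassenPreorder r) [IsOrderedRing R] {m n : ℕ}
    (hmn : r (m : R) n) : m ≤ n := by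
  by_contra! hlt
  refine h.not_succ_le n (h.trans (h.of_le ?_) hmn)
  exact_mod_cast (Nat.mono_cast hlt : ((n + 1 : ℕ) : R) ≤ (m : R))

/-- Adjoining a relation preserves every closure property automatically; the only thing that can
fail is `not_succ_le`, and the hypothesis is exactly that condition unfolded. -/
theorem adjoinLE_of_forall_not (h : IsStrassenPreorder r) (a b : R)
    (hab : ∀ (m : ℕ) (s : R), ¬ r (m + 1 + s * b) (m + s * a)) :
    IsStrassenPreorder (adjoinLE r a b) where
  of_le := fun hxy => ⟨0, by simpa using h.of_le hxy⟩
  trans := by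
    rintro x y z ⟨s, hs⟩ ⟨t, ht⟩
    refine ⟨s + t, ?_⟩
    have h1 := h.add_right hs (t * b)
    have h2 := h.add_right ht (s * a)
    rw [show x + (s + t) * b = x + s * b + t * b by ring,
      show z + (s + t) * a = z + t * a + s * a by ring]
    refine h.trans h1 ?_
    rwa [show y + s * a + t * b = y + t * b + s * a by ring]
  add_right := by
    rintro x y ⟨s, hs⟩ c
    refine ⟨s, ?_⟩
    rw [add_right_comm, add_right_comm y]
    exact h.add_right hs c
  mul_left := by
    rintro x y ⟨s, hs⟩ c
    refine ⟨c * s, ?_⟩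
    rw [mul_assoc, mul_assoc, ← mul_add, ← mul_add]
    exact h.mul_left hs c
  not_succ_le := fun m ⟨s, hs⟩ => hab m s hs

variable [IsOrderedRing R]

/-- Cancellation cannot create a contradiction because a nonzero factor is at least 1 and everything
is bounded by naturals. This is what makes a maximal preorder cancellative. -/
theorem of_cancelClosure (h : IsStrassenPreorder r) (hb : ∀ a : R, ∃ n : ℕ, a ≤ n)
    (h1 : ∀ a : R, a ≠ 0 → 1 ≤ a) : IsStrassenPreorder (cancelClosure r) where
  of_le := by
    intro a b hab
    refine ⟨1, 0, ?_, by simpa using h.of_le hab⟩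
    intro h0
    exact h.not_succ_le 0 (h.of_le (by simp [h0]))
  trans := by
    rintro x y w ⟨s, z, hs, hxy⟩ ⟨t, z', ht, hyw⟩
    refine ⟨s * t, t * z + s * z', ?_, ?_⟩
    · intro h0
      have := mul_le_mul (h1 s hs) (h1 t ht) zero_le_one (zero_le_one.trans (h1 s hs))
      rw [h0] at this
      exact h.not_succ_le 0 (h.of_le (by simpa using this))
    · have e1 := h.add_right (h.mul_left hxy t) (s * z')
      have e2 := h.add_right (h.mul_left hyw s) (t * z)
      rw [show s * t * x + (t * z + s * z') = t * (s * x + z) + s * z' by ring,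
        show s * t * w + (t * z + s * z') = s * (t * w + z') + t * z by ring]
      refine h.trans e1 ?_
      rwa [show t * (s * y + z) + s * z' = s * (t * y + z') + t * z by ring]
  add_right := by
    rintro x y ⟨s, z, hs, hxy⟩ c
    refine ⟨s, z, hs, ?_⟩
    have := h.add_right hxy (s * c)
    rwa [show s * (x + c) + z = s * x + z + s * c by ring,
      show s * (y + c) + z = s * y + z + s * c by ring]
  mul_left := by
    rintro x y ⟨s, z, hs, hxy⟩ c
    refine ⟨s, c * z, hs, ?_⟩
    have := h.mul_left hxy c
    rwa [show s * (c * x) + c * z = c * (s * x + z) by ring,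
      show s * (c * y) + c * z = c * (s * y + z) by ring]
  not_succ_le := by
    rintro m ⟨s, z, hs, hm⟩
    -- With w = s m + z, the assumption reads w + s ≤ w. Iterating it n + 1 times, where w ≤ n, and
    -- using 1 ≤ s gives n + 1 ≤ n.
    obtain ⟨n, hn⟩ := hb (s * m + z)
    have key : ∀ k : ℕ, r (s * m + z + k * s) (s * m + z) := by
      intro k
      induction k with
      | zero => simpa using h.of_le le_rfl
      | succ k ih =>
        refine h.trans ?_ ih
        have := h.add_right hm (k * s)
        rwa [show s * m + z + ((k + 1 : ℕ) : R) * s = s * (m + 1) + z + k * s by push_cast; ring]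
    have hle : ((n + 1 : ℕ) : R) ≤ s * m + z + ((n + 1 : ℕ) : R) * s := by
      have e1 : ((n + 1 : ℕ) : R) * 1 ≤ ((n + 1 : ℕ) : R) * s :=
        mul_le_mul_of_nonneg_left (h1 s hs) (Nat.cast_nonneg _)
      have e0 : ∀ a : R, 0 ≤ a := fun a => by
        by_cases ha : a = 0
        · rw [ha]
        · exact zero_le_one.trans (h1 a ha)
      calc ((n + 1 : ℕ) : R) = 0 + ((n + 1 : ℕ) : R) * 1 := by simp
        _ ≤ _ := add_le_add (e0 _) e1
    have := h.natCast_le (h.trans (h.of_le hle) (h.trans (key (n + 1)) (h.of_le hn)))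
    omega

end IsStrassenPreorder

/-- Every Strassen preorder extends to a total one. -/
theorem IsStrassenPreorder.exists_total_extension [IsOrderedRing R] {r : R → R → Prop}
    (h : IsStrassenPreorder r) (hb : ∀ a : R, ∃ n : ℕ, a ≤ n)
    (h1 : ∀ a : R, a ≠ 0 → 1 ≤ a) :
    ∃ t : R → R → Prop, IsStrassenPreorder t ∧ r ≤ t ∧ ∀ a b, t a b ∨ t b a := by
  obtain ⟨t, hrt, ht⟩ := zorn_le_nonempty₀ {t : R → R → Prop | IsStrassenPreorder t} (by
    intro C hC hchain t₀ ht₀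
    have hdir : ∀ {t t'}, t ∈ C → t' ∈ C → ∃ t'' ∈ C, t ≤ t'' ∧ t' ≤ t'' := by
      intro t t' h h'
      rcases hchain.total h h' with h2 | h2
      · exact ⟨t', h', h2, le_rfl⟩
      · exact ⟨t, h, le_rfl, h2⟩
    refine ⟨fun a b => ∃ t ∈ C, t a b, ?_, fun t ht a b hab => ⟨t, ht, hab⟩⟩
    exact {
      of_le := fun hab => ⟨t₀, ht₀, (hC ht₀).of_le hab⟩
      trans := by
        rintro a b c ⟨t, ht, hab⟩ ⟨t', ht', hbc⟩
        obtain ⟨t'', h'', hl, hl'⟩ := hdir ht ht'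
        exact ⟨t'', h'', (hC h'').trans (hl _ _ hab) (hl' _ _ hbc)⟩
      add_right := fun ⟨t, ht, hab⟩ c => ⟨t, ht, (hC ht).add_right hab c⟩
      mul_left := fun ⟨t, ht, hab⟩ c => ⟨t, ht, (hC ht).mul_left hab c⟩
      not_succ_le := fun m ⟨t, ht, hm⟩ => (hC ht).not_succ_le m hm }) r h
  have hS : IsStrassenPreorder t := ht.prop
  -- By maximality, `t` contains its own cancellation closure.
  have hcancel : ∀ s z x y : R, s ≠ 0 → t (s * x + z) (s * y + z) → t x y := by
    have hle : t ≤ cancelClosure t := by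
      intro x y hxy
      refine ⟨1, 0, ?_, by simpa using hxy⟩
      intro h0
      exact hS.not_succ_le 0 (hS.of_le (by simp [h0]))
    intro s z x y hs hxy
    exact ht.le_of_ge (hS.of_cancelClosure hb h1) hle _ _ ⟨s, z, hs, hxy⟩
  refine ⟨t, hS, hrt, fun a b => ?_⟩
  by_contra! hab
  -- If adjoining a ≤ b produced a contradiction, dropping the summand 1 and cancelling would give b
  -- ≤ a, which is excluded; so the extension is legitimate and maximality puts a ≤ b in `t`.
  have hne : ∀ (m : ℕ) (s : R), ¬ t (m + 1 + s * b) (m + s * a) := by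
    intro m s hms
    have hone : (1 : R) ≠ 0 := fun h0 => hS.not_succ_le 0 (hS.of_le (by simp [h0]))
    have hs : s ≠ 0 := by
      rintro rfl
      exact hS.not_succ_le m (by simpa using hms)
    refine hab.2 (hcancel s m _ _ hs ?_)
    rw [add_comm, add_comm (s * a)]
    refine hS.trans (hS.of_le ?_) hms
    gcongr
    exact le_add_of_nonneg_right zero_le_one
  refine hab.1 (ht.le_of_ge (hS.adjoinLE_of_forall_not a b hne) ?_ _ _ ⟨1, ?_⟩)
  · exact fun x y hxy => ⟨0, by simpa using hxy⟩
  · rw [one_mul, one_mul, add_comm]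
    exact hS.of_le le_rfl

end Strassen

/-! ### From total preorders to real-valued homomorphisms -/

section StrassenPoint

variable {R : Type*} [CommSemiring R] {t : R → R → Prop}

/-- The infimum of the fractions `p / q` such that `q * a` is below `p`. -/
noncomputable def ratUpper (t : R → R → Prop) (a : R) : ℝ :=
  sInf {x : ℝ | ∃ p q : ℕ, 0 < q ∧ t (q * a) p ∧ x = p / q}

theorem ratUpper_le (p q : ℕ) (a : R) (hq : 0 < q) (h : t (q * a) p) :
    q * ratUpper t a ≤ p := by
  have hq' : (0 : ℝ) < q := by exact_mod_cast hq
  rw [mul_comm, ← le_div_iff₀ hq']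
  exact csInf_le ⟨0, by rintro _ ⟨p, q, -, -, rfl⟩; positivity⟩ ⟨p, q, hq, h, rfl⟩

variable [PartialOrder R] [IsOrderedRing R]

namespace IsStrassenPreorder

/-- Cross-multiplication compares a lower fraction with each upper fraction, so it lies below their
infimum. Boundedness by naturals keeps the set of upper fractions nonempty, so `sInf` is not a
default value. -/
theorem le_ratUpper (ht : IsStrassenPreorder t) (hb : ∀ a : R, ∃ n : ℕ, a ≤ n) (p q : ℕ) (a : R)
    (hq : 0 < q) (h : t p (q * a)) : p ≤ q * ratUpper t a := by
  have hq' : (0 : ℝ) < q := by exact_mod_cast hq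
  rw [mul_comm, ← div_le_iff₀ hq']
  refine le_csInf ?_ ?_
  · obtain ⟨n, hn⟩ := hb a
    exact ⟨_, n, 1, one_pos, ht.of_le (by simpa using hn), rfl⟩
  · rintro _ ⟨p', q', hq2, h', rfl⟩
    have hq2' : (0 : ℝ) < q' := by exact_mod_cast hq2
    rw [div_le_div_iff₀ hq' hq2']
    have e1 := ht.mul_left h q'
    have e2 := ht.mul_left h' q
    rw [mul_left_comm] at e1
    have := ht.natCast_le (m := q' * p) (n := q * p') (by push_cast; exact ht.trans e1 e2)
    have h3 : (q' * p : ℝ) ≤ q * p' := by exact_mod_cast this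
    linarith

/-- In a total Strassen preorder, every multiple of an element lies between two consecutive
natural numbers. -/
theorem exists_natCast_le (ht : IsStrassenPreorder t) (hb : ∀ a : R, ∃ n : ℕ, a ≤ n)
    (h0 : ∀ a : R, 0 ≤ a) (htot : ∀ a b, t a b ∨ t b a) (a : R) :
    ∃ n : ℕ, t n a ∧ t a (n + 1 : ℕ) := by
  classical
  have hex : ∃ n : ℕ, t a (n + 1 : ℕ) := by
    obtain ⟨n, hn⟩ := hb a
    exact ⟨n, ht.of_le (hn.trans (Nat.mono_cast n.le_succ))⟩
  refine ⟨Nat.find hex, ?_, Nat.find_spec hex⟩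
  rcases hn : Nat.find hex with _ | m
  · simpa using ht.of_le (h0 a)
  · exact (htot _ _).resolve_right (Nat.find_min hex (by omega))

/-- A total Strassen preorder is refined by a monotone semiring homomorphism to the reals. -/
theorem exists_orderRingHom (ht : IsStrassenPreorder t) (hb : ∀ a : R, ∃ n : ℕ, a ≤ n)
    (h0 : ∀ a : R, 0 ≤ a) (htot : ∀ a b, t a b ∨ t b a) :
    ∃ φ : R →+*o ℝ, ∀ a b, t a b → φ a ≤ φ b := by
  have hfl := ht.exists_natCast_le hb h0 htot
  have hmono : ∀ a b, t a b → ratUpper t a ≤ ratUpper t b := by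
    intro a b hab
    refine le_of_forall_pos_le_add fun ε hε => ?_
    obtain ⟨n, hn⟩ := exists_nat_one_div_lt hε
    -- The integer part of (n + 1) b determines the values at a and b up to an error 1 / (n + 1) <
    -- ε.
    obtain ⟨p, hp1, hp2⟩ := hfl ((n + 1 : ℕ) * b)
    have e1 := ratUpper_le _ _ _ n.succ_pos (ht.trans (ht.mul_left hab (n + 1 : ℕ)) hp2)
    have e2 := ht.le_ratUpper hb _ _ _ n.succ_pos hp1
    have hpos : (0 : ℝ) < n + 1 := by positivity
    rw [div_lt_iff₀ hpos] at hn
    push_cast at e1 e2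
    nlinarith
  have hnat : ∀ n : ℕ, ratUpper t (n : R) = n := by
    intro n
    refine le_antisymm ?_ ?_
    · simpa using ratUpper_le n 1 (n : R) one_pos (ht.of_le (by simp))
    · simpa using ht.le_ratUpper hb n 1 (n : R) one_pos (ht.of_le (by simp))
  have habs : ∀ x C : ℝ, (∀ q : ℕ, 0 < q → q * |x| ≤ C) → x = 0 := by
    intro x C hx
    by_contra hne
    obtain ⟨n, hn⟩ := exists_nat_gt (C / |x|)
    have hpos := abs_pos.2 hne
    rw [div_lt_iff₀ hpos] at hn
    have := hx (n + 1) n.succ_pos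
    push_cast at this
    linarith
  have hadd : ∀ a b, ratUpper t (a + b) = ratUpper t a + ratUpper t b := by
    intro a b
    -- Both q (a + b) and the sum of the separate bounds lie in [m + n, m + n + 2], so the defect
    -- times q stays bounded by 2.
    refine sub_eq_zero.1 (habs _ 2 fun q hq => ?_)
    obtain ⟨m, hm1, hm2⟩ := hfl (q * a)
    obtain ⟨n, hn1, hn2⟩ := hfl (q * b)
    have e1 := ratUpper_le _ _ _ hq hm2
    have e2 := ratUpper_le _ _ _ hq hn2
    have e3 := ht.le_ratUpper hb _ _ _ hq hm1
    have e4 := ht.le_ratUpper hb _ _ _ hq hn1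
    have e5 := ratUpper_le (m + 1 + (n + 1)) q (a + b) hq (by
      rw [mul_add, Nat.cast_add]; exact ht.add hm2 hn2)
    have e6 := ht.le_ratUpper hb (m + n) q (a + b) hq (by
      rw [mul_add, Nat.cast_add]; exact ht.add hm1 hn1)
    push_cast at e1 e2 e5 e6
    rw [← abs_of_nonneg (Nat.cast_nonneg (α := ℝ) q), ← abs_mul, abs_le]
    constructor <;> linarith
  have hpos : ∀ a, 0 ≤ ratUpper t a := fun a => by
    have := hmono 0 a (ht.of_le (h0 a))
    rwa [← Nat.cast_zero, hnat, Nat.cast_zero] at this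
  have hmul : ∀ a b, ratUpper t (a * b) = ratUpper t a * ratUpper t b := by
    intro a b
    -- At scale q², both sides lie in [m n, (m + 1)(n + 1)], an interval of length m + n + 1. Since
    -- m and n are at most q times the values at a and b, this is at most q times the stated
    -- constant, and one factor q cancels.
    refine sub_eq_zero.1 (habs _ (ratUpper t a + ratUpper t b + 1) fun q hq => ?_)
    obtain ⟨m, hm1, hm2⟩ := hfl (q * a)
    obtain ⟨n, hn1, hn2⟩ := hfl (q * b)
    have e1 := ratUpper_le _ _ _ hq hm2
    have e2 := ratUpper_le _ _ _ hq hn2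
    have e3 := ht.le_ratUpper hb _ _ _ hq hm1
    have e4 := ht.le_ratUpper hb _ _ _ hq hn1
    have hre : ((q * q : ℕ) : R) * (a * b) = q * a * (q * b) := by push_cast; ring
    have e5 := ratUpper_le ((m + 1) * (n + 1)) (q * q) (a * b) (by positivity) (by
      rw [hre, Nat.cast_mul]; exact ht.mul hm2 hn2)
    have e6 := ht.le_ratUpper hb (m * n) (q * q) (a * b) (by positivity) (by
      rw [hre, Nat.cast_mul]; exact ht.mul hm1 hn1)
    push_cast at e1 e2 e5 e6
    have hq' : (1 : ℝ) ≤ q := by exact_mod_cast hq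
    have hx := mul_le_mul e3 e4 (by positivity) (by have := hpos a; positivity)
    have hy := mul_le_mul e1 e2 (by have := hpos b; positivity) (by positivity)
    have h2 : (q : ℝ) * (q * |ratUpper t (a * b) - ratUpper t a * ratUpper t b|) ≤
        q * (ratUpper t a + ratUpper t b + 1) := by
      rw [← mul_assoc, ← abs_of_nonneg (mul_self_nonneg (q : ℝ)), ← abs_mul, abs_le]
      constructor <;> nlinarith
    exact le_of_mul_le_mul_left h2 (by linarith)
  exact ⟨{
    toFun := ratUpper t
    map_one' := by simpa using hnat 1
    map_mul' := hmul
    map_zero' := by simpa using hnat 0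
    map_add' := hadd
    monotone' := fun a b hab => hmono a b (ht.of_le hab) }, hmono⟩

end IsStrassenPreorder

/-- If `y ≤ x` does not follow from the order by cancellation, then some monotone semiring
homomorphism to the reals satisfies `φ x ≤ φ y`. -/
theorem exists_orderRingHom_le [Nontrivial R] (hb : ∀ a : R, ∃ n : ℕ, a ≤ n)
    (h1 : ∀ a : R, a ≠ 0 → 1 ≤ a) (x y : R)
    (hxy : ∀ s z : R, s ≠ 0 → ¬ s * y + z ≤ s * x + z) :
    ∃ φ : R →+*o ℝ, φ x ≤ φ y := by
  have h0 : ∀ a : R, 0 ≤ a := fun a => by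
    by_cases ha : a = 0
    · rw [ha]
    · exact zero_le_one.trans (h1 a ha)
  have hle : IsStrassenPreorder (fun a b : R => a ≤ b) :=
    { of_le := fun h => h
      trans := fun h h' => h.trans h'
      add_right := fun h c => by gcongr
      mul_left := fun h c => mul_le_mul_of_nonneg_left h (h0 c)
      not_succ_le := by
        -- If the order itself had m + 1 ≤ m, then k + m ≤ m for every k, hence y + m ≤ m ≤ x + m,
        -- against `hxy` with s = 1 and z = m.
        intro m hm
        have key : ∀ k : ℕ, (k : R) + m ≤ m := by
          intro k
          induction k with
          | zero => simp
          | succ k ih =>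
            calc ((k + 1 : ℕ) : R) + m = k + (m + 1) := by push_cast; ring
              _ ≤ k + m := by gcongr
              _ ≤ m := ih
        obtain ⟨n, hn⟩ := hb y
        refine hxy 1 m one_ne_zero ?_
        rw [one_mul, one_mul]
        calc y + m ≤ n + m := by gcongr
          _ ≤ m := key n
          _ ≤ x + m := le_add_of_nonneg_left (h0 x) }
  obtain ⟨t, ht, hlt, htot⟩ := (hle.adjoinLE_of_forall_not x y fun m s hms => by
    have hs : s ≠ 0 := by
      rintro rfl
      exact hle.not_succ_le m (by simpa using hms)
    refine hxy s m hs ?_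
    rw [add_comm, add_comm (s * x)]
    refine le_trans ?_ hms
    gcongr
    exact le_add_of_nonneg_right zero_le_one).exists_total_extension hb h1
  obtain ⟨φ, hφ⟩ := ht.exists_orderRingHom hb h0 htot
  refine ⟨φ, hφ _ _ (hlt _ _ ⟨1, ?_⟩)⟩
  rw [one_mul, one_mul, add_comm]

/-- A cancellable inequality holds for powers up to a constant factor. -/
theorem exists_pow_le_mul_pow (hb : ∀ a : R, ∃ n : ℕ, a ≤ n) (h1 : ∀ a : R, a ≠ 0 → 1 ≤ a)
    {x y s z : R} (hy : 1 ≤ y) (hs : s ≠ 0) (h : s * x + z ≤ s * y + z) :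
    ∃ r : ℕ, ∀ k N : ℕ, (k * x) ^ N ≤ r * ((k + r) * y) ^ N := by
  have h0 : ∀ a : R, 0 ≤ a := fun a => by
    by_cases ha : a = 0
    · rw [ha]
    · exact zero_le_one.trans (h1 a ha)
  obtain ⟨r, hr⟩ := hb (s + z)
  have hsr : s ≤ r := (le_add_of_nonneg_right (h0 z)).trans hr
  have hzr : z ≤ r := (le_add_of_nonneg_left (h0 s)).trans hr
  refine ⟨r, fun k N => ?_⟩
  -- The summand z acts as a catalyst that is reused at each step, so its cost does not grow with k.
  have hiter : ∀ k : ℕ, k * (s * x) + z ≤ k * (s * y) + z := by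
    intro k
    induction k with
    | zero => simp
    | succ k ih =>
      calc ((k + 1 : ℕ) : R) * (s * x) + z = k * (s * x) + z + s * x := by push_cast; ring
        _ ≤ k * (s * y) + z + s * x := by gcongr
        _ = k * (s * y) + (s * x + z) := by ring
        _ ≤ k * (s * y) + (s * y + z) := by gcongr
        _ = ((k + 1 : ℕ) : R) * (s * y) + z := by push_cast; ring
  -- The catalyst z is absorbed through z ≤ r ≤ r s y, which replaces k by k + r. The factor s is
  -- then reused in the same way for powers, and costs only a final factor r.
  have hstep : s * (k * x) ≤ s * ((k + r) * y) := by
    have hsy : (r : R) * 1 ≤ r * (s * y) := by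
      refine mul_le_mul_of_nonneg_left ?_ (h0 _)
      have := mul_le_mul (h1 s hs) hy zero_le_one (h0 s)
      rwa [one_mul] at this
    calc s * (k * x) = k * (s * x) := by ring
      _ ≤ k * (s * x) + z := le_add_of_nonneg_right (h0 z)
      _ ≤ k * (s * y) + z := hiter k
      _ ≤ k * (s * y) + r * 1 := by rw [mul_one]; gcongr
      _ ≤ k * (s * y) + r * (s * y) := by gcongr
      _ = s * ((k + r) * y) := by ring
  have hpow : ∀ N : ℕ, s * (k * x) ^ N ≤ s * ((k + r) * y) ^ N := by
    intro N
    induction N with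
    | zero => simp
    | succ N ih =>
      calc s * (k * x) ^ (N + 1) = k * x * (s * (k * x) ^ N) := by ring
        _ ≤ k * x * (s * ((k + r) * y) ^ N) := mul_le_mul_of_nonneg_left ih (h0 _)
        _ = s * (k * x) * ((k + r) * y) ^ N := by ring
        _ ≤ s * ((k + r) * y) * ((k + r) * y) ^ N := mul_le_mul_of_nonneg_right hstep (h0 _)
        _ = s * ((k + r) * y) ^ (N + 1) := by ring
  calc (k * x) ^ N = 1 * (k * x) ^ N := (one_mul _).symm
    _ ≤ s * (k * x) ^ N := mul_le_mul_of_nonneg_right (h1 s hs) (h0 _)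
    _ ≤ s * ((k + r) * y) ^ N := hpow N
    _ ≤ r * ((k + r) * y) ^ N := mul_le_mul_of_nonneg_right hsr (h0 _)

/-- If b > 0, a ratio a / b > 1 would have powers exceeding the constant r; if b = 0, the exponent 1
already suffices. -/
theorem le_of_forall_pow_le_mul_pow {a b r : ℝ} (hb : 0 ≤ b)
    (h : ∀ N : ℕ, a ^ N ≤ r * b ^ N) : a ≤ b := by
  by_contra! hab
  rcases hb.eq_or_lt with rfl | hb'
  · have := h 1
    simp only [pow_one, mul_zero] at this
    linarith
  · obtain ⟨N, hN⟩ := pow_unbounded_of_one_lt r ((one_lt_div hb').2 hab)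
    rw [div_pow, lt_div_iff₀ (by positivity)] at hN
    exact absurd (h N) (not_le.2 hN)

/-- Let `c` be such that `p ≤ q * h ^ N` implies `p ≤ q * c ^ N` for natural numbers `p`, `q`, `N`.
Then for every fraction larger than `c`, some monotone semiring homomorphism to the reals takes a
value at `h` that is at most this fraction. -/
theorem exists_orderRingHom_apply_le [Nontrivial R] (hb : ∀ a : R, ∃ n : ℕ, a ≤ n)
    (h1 : ∀ a : R, a ≠ 0 → 1 ≤ a) {h : R} (hh : h ≠ 0) {c : ℝ} (hc : 0 ≤ c)
    (hD : ∀ p q N : ℕ, (p : R) ≤ q * h ^ N → (p : ℝ) ≤ q * c ^ N) {p q : ℕ} (hq : 0 < q)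
    (hpq : q * c < p) : ∃ φ : R →+*o ℝ, q * φ h ≤ p := by
  obtain ⟨φ, hφ⟩ := exists_orderRingHom_le hb h1 (q * h) p (by
    intro s z hs hsz
    have hqh : (1 : R) ≤ q * h := by
      have hq1 : (1 : R) ≤ q := by simpa using (Nat.mono_cast hq : ((1 : ℕ) : R) ≤ q)
      have := mul_le_mul hq1 (h1 h hh) zero_le_one (Nat.cast_nonneg q)
      rwa [one_mul] at this
    obtain ⟨r, hr⟩ := exists_pow_le_mul_pow hb h1 hqh hs hsz
    have hk : ∀ k : ℕ, (k * p : ℝ) ≤ (k + r) * q * c := by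
      intro k
      refine le_of_forall_pow_le_mul_pow (r := r) (by positivity) fun N => ?_
      have := hD ((k * p) ^ N) (r * ((k + r) * q) ^ N) N (by
        refine le_of_eq_of_le (by push_cast; rfl) ((hr k N).trans_eq ?_)
        push_cast
        rw [mul_assoc (r : R), ← mul_pow, mul_assoc])
      push_cast at this
      rwa [mul_pow _ c, ← mul_assoc]
    -- The N-th powers have removed the constant r; the remaining loss (k + r) / k tends to 1, and
    -- this k is large enough to contradict q c < p.
    obtain ⟨k, hk'⟩ := exists_nat_gt (r * q * c / (p - q * c))
    rw [div_lt_iff₀ (by linarith)] at hk'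
    have := hk k
    nlinarith)
  exact ⟨φ, by simpa using hφ⟩

end StrassenPoint

/-! ### The ordered semiring of graphs up to homomorphic equivalence -/

namespace FinGraph

instance : Preorder FinGraph.{u} where
  le := HomTo
  le_refl _ := ⟨SimpleGraph.Hom.id⟩
  le_trans _ _ _ := fun ⟨f⟩ ⟨g⟩ => ⟨g.comp f⟩

theorem antisymmRel_of_equiv {F G : FinGraph.{u}} (e : F.V ≃ G.V)
    (h : ∀ a b, G.graph.Adj (e a) (e b) ↔ F.graph.Adj a b) : AntisymmRel (· ≤ ·) F G := by
  let i : F.graph ≃g G.graph := ⟨e, h _ _⟩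
  exact ⟨⟨i.toHom⟩, ⟨i.symm.toHom⟩⟩

/-- The empty graph. -/
def K0 : FinGraph.{u} where
  V := PEmpty.{u + 1}
  graph := ⊥

theorem le_of_isEmpty {F G : FinGraph.{u}} [IsEmpty F.V] : F ≤ G :=
  ⟨⟨isEmptyElim, fun {a} => isEmptyElim a⟩⟩

theorem join_le_join {F F' G G' : FinGraph.{u}} (h : F ≤ F') (h' : G ≤ G') :
    F.join G ≤ F'.join G' := by
  obtain ⟨f⟩ := h
  obtain ⟨g⟩ := h'
  refine ⟨⟨Sum.map f g, ?_⟩⟩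
  rintro (a | a) (b | b) hab
  · exact f.map_adj hab
  · trivial
  · trivial
  · exact g.map_adj hab

theorem orProd_le_orProd {F F' G G' : FinGraph.{u}} (h : F ≤ F') (h' : G ≤ G') :
    F.orProd G ≤ F'.orProd G' := by
  obtain ⟨f⟩ := h
  obtain ⟨g⟩ := h'
  exact ⟨⟨Prod.map f g, fun hab => hab.imp f.map_adj g.map_adj⟩⟩

/-- Finite simple graphs up to homomorphic equivalence. -/
def HomClass : Type (u + 1) := Antisymmetrization FinGraph.{u} (· ≤ ·)

namespace HomClass

instance : PartialOrder HomClass.{u} :=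
  inferInstanceAs (PartialOrder (Antisymmetrization FinGraph.{u} (· ≤ ·)))

/-- The class of a graph. -/
def homClass (G : FinGraph.{u}) : HomClass.{u} := toAntisymmetrization (· ≤ ·) G

theorem homClass_le_iff {F G : FinGraph.{u}} : homClass F ≤ homClass G ↔ F.HomTo G := Iff.rfl

theorem homClass_eq_of_equiv {F G : FinGraph.{u}} (e : F.V ≃ G.V)
    (h : ∀ a b, G.graph.Adj (e a) (e b) ↔ F.graph.Adj a b) : homClass F = homClass G :=
  Quotient.sound (antisymmRel_of_equiv e h)

theorem ind {p : HomClass.{u} → Prop} (h : ∀ G, p (homClass G)) (a : HomClass.{u}) : p a :=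
  Quotient.ind h a

instance : Add HomClass.{u} :=
  ⟨Quotient.map₂ join fun _ _ h _ _ h' => ⟨join_le_join h.1 h'.1, join_le_join h.2 h'.2⟩⟩

instance : Mul HomClass.{u} :=
  ⟨Quotient.map₂ orProd fun _ _ h _ _ h' => ⟨orProd_le_orProd h.1 h'.1, orProd_le_orProd h.2 h'.2⟩⟩

instance : Zero HomClass.{u} := ⟨homClass K0⟩

instance : One HomClass.{u} := ⟨homClass K1⟩

theorem homClass_join (F G : FinGraph.{u}) : homClass (F.join G) = homClass F + homClass G := rfl

theorem homClass_orProd (F G : FinGraph.{u}) : homClass (F.orProd G) = homClass F * homClass G := rfl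

theorem homClass_K1 : homClass K1.{u} = 1 := rfl

instance : CommSemiring HomClass.{u} where
  add_assoc := by
    refine ind fun F => ind fun G => ind fun H => homClass_eq_of_equiv (Equiv.sumAssoc _ _ _) ?_
    rintro ((a | a) | a) ((b | b) | b) <;> rfl
  zero_add := by
    refine ind fun F => homClass_eq_of_equiv (Equiv.emptySum PEmpty _) ?_
    rintro (⟨⟨⟩⟩ | a) (⟨⟨⟩⟩ | b)
    rfl
  add_zero := by
    refine ind fun F => homClass_eq_of_equiv (Equiv.sumEmpty _ PEmpty) ?_
    rintro (a | ⟨⟨⟩⟩) (b | ⟨⟨⟩⟩)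
    rfl
  add_comm := by
    refine ind fun F => ind fun G => homClass_eq_of_equiv (Equiv.sumComm _ _) ?_
    rintro (a | a) (b | b) <;> rfl
  nsmul := nsmulRec
  left_distrib := by
    refine ind fun F => ind fun G => ind fun H => homClass_eq_of_equiv (Equiv.prodSumDistrib _ _ _) ?_
    rintro ⟨a, (x | x)⟩ ⟨b, (y | y)⟩
    · rfl
    · exact iff_of_true trivial (Or.inr trivial)
    · exact iff_of_true trivial (Or.inr trivial)
    · rfl
  right_distrib := by
    refine ind fun F => ind fun G => ind fun H => homClass_eq_of_equiv (Equiv.sumProdDistrib _ _ _) ?_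
    rintro ⟨(x | x), a⟩ ⟨(y | y), b⟩
    · rfl
    · exact iff_of_true trivial (Or.inl trivial)
    · exact iff_of_true trivial (Or.inl trivial)
    · rfl
  zero_mul := by
    refine ind fun F => homClass_eq_of_equiv (Equiv.pemptyProd _) ?_
    rintro ⟨⟨⟩, _⟩
  mul_zero := by
    refine ind fun F => homClass_eq_of_equiv (Equiv.prodPEmpty _) ?_
    rintro ⟨_, ⟨⟩⟩
  mul_assoc := by
    refine ind fun F => ind fun G => ind fun H => homClass_eq_of_equiv (Equiv.prodAssoc _ _ _) ?_
    intro _ _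
    exact or_assoc.symm
  one_mul := by
    refine ind fun F => homClass_eq_of_equiv (Equiv.punitProd _) ?_
    intro _ _
    exact ⟨Or.inr, fun h => h.resolve_left fun h => h.elim⟩
  mul_one := by
    refine ind fun F => homClass_eq_of_equiv (Equiv.prodPUnit _) ?_
    intro _ _
    exact ⟨Or.inl, fun h => h.resolve_right fun h => h.elim⟩
  mul_comm := by
    refine ind fun F => ind fun G => homClass_eq_of_equiv (Equiv.prodComm _ _) ?_
    intro _ _
    exact or_comm

protected theorem zero_le (a : HomClass.{u}) : 0 ≤ a := by
  induction a using ind with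
  | h G =>
    have : IsEmpty K0.V := inferInstanceAs (IsEmpty PEmpty)
    exact le_of_isEmpty (F := K0)

instance : IsOrderedRing HomClass.{u} where
  add_le_add_left := by
    refine ind fun F => ind fun G h => ind fun H => ?_
    exact join_le_join h le_rfl
  zero_le_one := HomClass.zero_le _
  mul_le_mul_of_nonneg_left := by
    refine ind fun F _ => ind fun G => ind fun H h => ?_
    exact orProd_le_orProd le_rfl h
  mul_le_mul_of_nonneg_right := by
    refine ind fun F _ => ind fun G => ind fun H h => ?_
    exact orProd_le_orProd h le_rfl

instance : Nontrivial HomClass.{u} := by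
  refine ⟨1, 0, fun h => ?_⟩
  obtain ⟨f⟩ := homClass_le_iff.1 h.le
  exact (f PUnit.unit).elim

end HomClass

/-! ### Clique numbers and capacity in the semiring -/

open HomClass

theorem one_le_homClass (G : FinGraph.{u}) [hG : Nonempty G.V] : 1 ≤ homClass G :=
  ⟨⟨fun _ => hG.some, fun h => h.elim⟩⟩

theorem homClass_eq_zero (G : FinGraph.{u}) [IsEmpty G.V] : homClass G = 0 :=
  le_antisymm le_of_isEmpty (HomClass.zero_le _)

/-- The complete graph on `n` vertices. -/
def complete (n : ℕ) : FinGraph.{u} where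
  V := ULift.{u} (Fin n)
  graph := ⊤

theorem homClass_complete (n : ℕ) : homClass (complete.{u} n) = n := by
  induction n with
  | zero =>
    have : IsEmpty (complete.{u} 0).V := inferInstanceAs (IsEmpty (ULift (Fin 0)))
    rw [homClass_eq_zero, Nat.cast_zero]
  | succ n ih =>
    rw [Nat.cast_succ, ← ih, ← homClass_K1, ← homClass_join]
    let e : ULift.{u} (Fin n) ⊕ PUnit.{u + 1} ≃ ULift.{u} (Fin (n + 1)) :=
      (Equiv.sumCongr Equiv.ulift (Equiv.equivPUnit (Fin 1)).symm).trans
        (finSumFinEquiv.trans Equiv.ulift.symm)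
    refine (homClass_eq_of_equiv (F := (complete n).join K1) (G := complete (n + 1)) e ?_).symm
    intro a b
    refine (e.injective.ne_iff (x := a) (y := b)).trans ?_
    rcases a with a | a <;> rcases b with b | b
    · exact Sum.inl_injective.ne_iff
    · exact iff_of_true Sum.inl_ne_inr trivial
    · exact iff_of_true Sum.inr_ne_inl trivial
    · exact iff_of_false (fun h => h rfl) (fun h => h.elim)

/-- A homomorphism from a complete graph is injective because the target has no loops, so its image
is a clique. This translates clique numbers into the order of the semiring. -/
theorem natCast_le_homClass_iff (n : ℕ) (G : FinGraph.{u}) :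
    (n : HomClass.{u}) ≤ homClass G ↔ n ≤ G.graph.cliqueNum := by
  rw [← homClass_complete, homClass_le_iff]
  constructor
  · rintro ⟨f⟩
    have hf : Function.Injective f := SimpleGraph.Hom.injective_of_top_hom f
    let g : Fin n ↪ G.V := ⟨fun i => f (ULift.up i), fun i j h => ULift.up_injective (hf h)⟩
    have := SimpleGraph.IsClique.card_le_cliqueNum (G := G.graph)
      (t := Finset.univ.map g) (tc := by
        intro x hx y hy hxy
        obtain ⟨i, -, rfl⟩ := Finset.mem_map.1 (Finset.mem_coe.1 hx)
        obtain ⟨j, -, rfl⟩ := Finset.mem_map.1 (Finset.mem_coe.1 hy)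
        exact f.map_adj fun h => hxy (congrArg f h))
    simpa using this
  · intro h
    obtain ⟨A, hA⟩ := G.graph.exists_isNClique_cliqueNum
    let e : Fin A.card ≃ A := A.equivFin.symm
    rw [← hA.card_eq] at h
    refine ⟨⟨fun i => (e (Fin.castLE h i.down) : G.V), ?_⟩⟩
    intro i j hij
    refine hA.isClique (e _).2 (e _).2 fun h' => hij ?_
    exact ULift.down_injective (Fin.castLE_injective h (e.injective (Subtype.ext h')))

theorem exists_le_natCast (a : HomClass.{u}) : ∃ n : ℕ, a ≤ n := by
  induction a using HomClass.ind with
  | h G =>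
    have := Fintype.ofFinite G.V
    refine ⟨Fintype.card G.V, ?_⟩
    rw [← homClass_complete, homClass_le_iff]
    let e := Fintype.equivFin G.V
    exact ⟨⟨fun v => ULift.up (e v), fun h h' => h.ne (e.injective (ULift.up_injective h'))⟩⟩

theorem one_le_of_ne_zero (a : HomClass.{u}) (ha : a ≠ 0) : 1 ≤ a := by
  induction a using HomClass.ind with
  | h G =>
    rcases isEmpty_or_nonempty G.V with hG | hG
    · exact absurd (homClass_eq_zero G) ha
    · exact one_le_homClass G

/-- In a clique of the product, the points over a fixed first coordinate have pairwise adjacent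
second coordinates, since `F` has no loops. Applied to a complete first factor, it turns p ≤ q h^N
into an inequality of numbers. -/
theorem cliqueNum_orProd_le (F G : FinGraph.{u}) :
    (F.orProd G).graph.cliqueNum ≤ Nat.card F.V * G.graph.cliqueNum := by
  classical
  have := Fintype.ofFinite F.V
  obtain ⟨A, hA⟩ := (F.orProd G).graph.exists_isNClique_cliqueNum
  have hA' : ∀ x ∈ A, ∀ y ∈ A, x ≠ y → F.graph.Adj x.1 y.1 ∨ G.graph.Adj x.2 y.2 :=
    fun x hx y hy h => hA.isClique hx hy h
  rw [← hA.card_eq, Nat.card_eq_fintype_card, mul_comm]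
  refine Finset.card_le_mul_card_image_of_maps_to (f := Prod.fst) (t := Finset.univ)
    (fun _ _ => Finset.mem_univ _) _ fun v _ => ?_
  rw [← Finset.card_image_of_injOn (f := Prod.snd)]
  · refine SimpleGraph.IsClique.card_le_cliqueNum (tc := ?_)
    intro x hx y hy hxy
    obtain ⟨⟨a, x'⟩, hx1, rfl⟩ := Finset.mem_image.1 (Finset.mem_coe.1 hx)
    obtain ⟨⟨b, y'⟩, hy1, rfl⟩ := Finset.mem_image.1 (Finset.mem_coe.1 hy)
    obtain ⟨hxA, rfl⟩ := Finset.mem_filter.1 hx1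
    obtain ⟨hyA, hb⟩ := Finset.mem_filter.1 hy1
    dsimp only at hb hxy ⊢
    subst hb
    refine (hA' _ hxA _ hyA fun h => hxy (congrArg Prod.snd h)).resolve_left fun h => ?_
    exact F.graph.irrefl h
  · intro x hx y hy hxy
    have hx := (Finset.mem_filter.1 (Finset.mem_coe.1 hx)).2
    have hy := (Finset.mem_filter.1 (Finset.mem_coe.1 hy)).2
    exact Prod.ext (hx.trans hy.symm) hxy

theorem homClass_orPow (G : FinGraph.{u}) (t : ℕ) : homClass (G.orPow t) = homClass G ^ t := by
  induction t with
  | zero =>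
    rw [pow_zero, ← homClass_K1]
    refine homClass_eq_of_equiv (F := G.orPow 0) (G := K1) (Equiv.ofUnique (Fin 0 → G.V) PUnit) ?_
    intro a b
    exact iff_of_false (fun h => h) (fun ⟨i, _⟩ => i.elim0)
  | succ t ih =>
    obtain ⟨e⟩ := G.orPow_succ_iso t
    rw [pow_succ', ← ih, ← homClass_orProd]
    exact homClass_eq_of_equiv e.toEquiv fun _ _ => e.map_adj_iff

theorem shannonOR_nonneg (G : FinGraph.{u}) : 0 ≤ G.shannonOR :=
  ge_of_tendsto' G.tendsto_orRate fun _ => Real.rpow_nonneg (Nat.cast_nonneg _) _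

theorem cliqueNum_orPow_le_of_homTo {F G : FinGraph.{u}} (h : F.HomTo G) (t : ℕ) :
    (F.orPow t).graph.cliqueNum ≤ (G.orPow t).graph.cliqueNum := by
  rw [← natCast_le_homClass_iff, homClass_orPow]
  refine le_trans ?_ (pow_le_pow_left₀ (HomClass.zero_le _) (homClass_le_iff.2 h) t)
  rw [← homClass_orPow, natCast_le_homClass_iff]

theorem shannonOR_le_of_homTo {F G : FinGraph.{u}} (h : F.HomTo G) :
    F.shannonOR ≤ G.shannonOR := by
  refine le_of_tendsto_of_tendsto' F.tendsto_orRate G.tendsto_orRate fun t => ?_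
  refine Real.rpow_le_rpow (Nat.cast_nonneg _) ?_ (by positivity)
  exact_mod_cast cliqueNum_orPow_le_of_homTo h t

theorem cliqueNum_orPow_pow_le (G : FinGraph.{u}) (t k : ℕ) :
    (G.orPow t).graph.cliqueNum ^ k ≤ (G.orPow (t * k)).graph.cliqueNum := by
  rw [← natCast_le_homClass_iff, homClass_orPow, pow_mul, Nat.cast_pow]
  refine pow_le_pow_left₀ (HomClass.zero_le _) ?_ k
  rw [← homClass_orPow, natCast_le_homClass_iff]

/-- By supermultiplicativity, the rate at t k is at least the rate at t for every k > 0; letting k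
grow bounds the rate at t by the capacity. -/
theorem cliqueNum_orPow_le_shannonOR_pow (G : FinGraph.{u}) (t : ℕ) :
    ((G.orPow t).graph.cliqueNum : ℝ) ≤ G.shannonOR ^ t := by
  rcases Nat.eq_zero_or_pos t with rfl | ht
  · have := G.cliqueNum_orPow_le 0
    rw [pow_zero] at this ⊢
    exact_mod_cast this
  · have hlim : Tendsto (fun k => G.orRate (t * k)) atTop (𝓝 G.shannonOR) :=
      G.tendsto_orRate.comp (tendsto_id.const_mul_atTop' ht)
    refine ge_of_tendsto (hlim.pow t) ?_
    filter_upwards [eventually_gt_atTop 0] with k hk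
    have htk : (0 : ℝ) < t := by exact_mod_cast ht
    have hk' : (k : ℝ) ≠ 0 := by exact_mod_cast hk.ne'
    have h1 : ((G.orPow t).graph.cliqueNum : ℝ) ^ k ≤ (G.orPow (t * k)).graph.cliqueNum := by
      exact_mod_cast G.cliqueNum_orPow_pow_le t k
    rw [orRate, ← Real.rpow_mul_natCast (Nat.cast_nonneg _), Nat.cast_mul,
      show 1 / ((t : ℝ) * k) * t = (k : ℝ)⁻¹ by field_simp]
    calc ((G.orPow t).graph.cliqueNum : ℝ)
        = (((G.orPow t).graph.cliqueNum : ℝ) ^ k) ^ (k : ℝ)⁻¹ :=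
          (Real.pow_rpow_inv_natCast (Nat.cast_nonneg _) hk.ne').symm
      _ ≤ _ := Real.rpow_le_rpow (by positivity) h1 (by positivity)

/-- A homomorphism to the reals fixes the naturals, so it sends the inequality ω(G^t) ≤ G^t in the
semiring to ω(G^t) ≤ φ(G)^t; then take t-th roots. -/
theorem shannonOR_le_orderRingHom (φ : HomClass.{u} →+*o ℝ) (G : FinGraph.{u}) :
    G.shannonOR ≤ φ (homClass G) := by
  refine le_of_tendsto G.tendsto_orRate ?_
  filter_upwards [eventually_gt_atTop 0] with t ht
  have hφ : 0 ≤ φ (homClass G) := by simpa using φ.monotone' (HomClass.zero_le (homClass G))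
  have h1 : (((G.orPow t).graph.cliqueNum : ℕ) : HomClass.{u}) ≤ homClass G ^ t := by
    rw [← homClass_orPow, natCast_le_homClass_iff]
  have h2 : ((G.orPow t).graph.cliqueNum : ℝ) ≤ φ (homClass G) ^ t := by
    have := OrderHomClass.mono φ h1
    rwa [map_natCast, map_pow] at this
  rw [orRate, one_div]
  calc _ ≤ (φ (homClass G) ^ t) ^ (t : ℝ)⁻¹ :=
        Real.rpow_le_rpow (Nat.cast_nonneg _) h2 (by positivity)
    _ = φ (homClass G) := Real.pow_rpow_inv_natCast hφ ht.ne'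

/-- Points of the asymptotic spectrum of all graphs take values at `G` arbitrarily close to the
Shannon OR-capacity of `G`. -/
theorem exists_orderRingHom_lt (G : FinGraph.{u}) [Nonempty G.V] {d : ℝ} (hd : G.shannonOR < d) :
    ∃ φ : HomClass.{u} →+*o ℝ, φ (homClass G) < d := by
  obtain ⟨x, hx1, hx2⟩ := exists_rat_btwn hd
  have hx0 : 0 ≤ x := by
    have := G.shannonOR_nonneg.trans hx1.le
    exact_mod_cast this
  have hq : (0 : ℝ) < x.den := by exact_mod_cast x.den_pos
  have hx : (x : ℝ) = x.num.natAbs / x.den := by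
    have h := Int.natAbs_of_nonneg (Rat.num_nonneg.2 hx0)
    have h' : ((x.num.natAbs : ℕ) : ℝ) = (x.num : ℝ) := by
      rw [← Int.cast_natCast, h]
    rw [h', ← Rat.cast_def]
  -- Nonemptiness is needed here: only a nonzero class is at least 1.
  have hne : homClass G ≠ 0 := fun h => by
    have := one_le_homClass G
    rw [h] at this
    exact absurd (le_antisymm this zero_le_one) one_ne_zero
  obtain ⟨φ, hφ⟩ := exists_orderRingHom_apply_le exists_le_natCast one_le_of_ne_zero hne
    G.shannonOR_nonneg (p := x.num.natAbs) (q := x.den) (by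
      intro p q N h
      rw [← homClass_complete q, ← homClass_orPow, ← homClass_orProd, natCast_le_homClass_iff] at h
      have h2 := h.trans (cliqueNum_orProd_le _ _)
      have h3 : Nat.card (complete.{u} q).V = q := by
        change Nat.card (ULift (Fin q)) = q
        simp
      rw [h3] at h2
      calc (p : ℝ) ≤ q * (G.orPow N).graph.cliqueNum := by exact_mod_cast h2
        _ ≤ q * G.shannonOR ^ N := by
          gcongr
          exact G.cliqueNum_orPow_le_shannonOR_pow N) x.den_pos (by
      rw [hx, lt_div_iff₀ hq] at hx1
      linarith)
  refine ⟨φ, lt_of_le_of_lt ?_ hx2⟩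
  rw [hx, le_div_iff₀ hq]
  linarith

/-- A monotone semiring homomorphism on classes of graphs, restricted to a family `S`. -/
def restrictHom (S : Set FinGraph.{u}) (φ : HomClass.{u} →+*o ℝ) (G : S) : ℝ≥0 :=
  ⟨φ (homClass G.1), by simpa using OrderHomClass.mono φ (HomClass.zero_le (homClass G.1))⟩

theorem restrictHom_mem {S : Set FinGraph.{u}} (hS : IsClosedFamily S)
    (φ : HomClass.{u} →+*o ℝ) : restrictHom S φ ∈ asymptoticSpectrum hS :=
  ⟨NNReal.eq (by exact map_one φ), fun G H => NNReal.eq (map_add φ (homClass G.1) (homClass H.1)),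
    fun G H => NNReal.eq (map_mul φ (homClass G.1) (homClass H.1)),
    fun _ _ h => OrderHomClass.mono φ (homClass_le_iff.2 h)⟩

end FinGraph

/-! ### The dichotomy -/

open FinGraph in
theorem mainTheorem1 (S : Set FinGraph.{u}) (hS : FinGraph.IsClosedFamily S)
    (F G : FinGraph.{u}) (hF : F ∈ S) (hG : G ∈ S) (hFG : F.catProd G ∈ S) :
    (F.catProd G).shannonOR = min F.shannonOR G.shannonOR ∨
      ∃ φ ∈ FinGraph.asymptoticSpectrum hS,
        φ ⟨F.catProd G, hFG⟩ < min (φ ⟨F, hF⟩) (φ ⟨G, hG⟩) := by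
  have hle : (F.catProd G).shannonOR ≤ min F.shannonOR G.shannonOR :=
    le_min (shannonOR_le_of_homTo ⟨⟨Prod.fst, fun h => h.1⟩⟩)
      (shannonOR_le_of_homTo ⟨⟨Prod.snd, fun h => h.2⟩⟩)
  refine hle.eq_or_lt.imp_right fun hlt => ?_
  -- An empty factor maps to the product, so its capacity would be at most that of the product,
  -- against strictness.
  have hF0 : Nonempty F.V := by
    by_contra! hE
    exact ((shannonOR_le_of_homTo le_of_isEmpty).trans_lt (lt_min_iff.1 hlt).1).false.elim
  have hG0 : Nonempty G.V := by
    by_contra! hE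
    exact ((shannonOR_le_of_homTo le_of_isEmpty).trans_lt (lt_min_iff.1 hlt).2).false.elim
  have : Nonempty (F.catProd G).V := inferInstanceAs (Nonempty (F.V × G.V))
  obtain ⟨φ, hφ⟩ := exists_orderRingHom_lt _ hlt
  obtain ⟨h1, h2⟩ := lt_min_iff.1 hφ
  exact ⟨restrictHom S φ, restrictHom_mem hS φ, lt_min
    (h1.trans_le (shannonOR_le_orderRingHom φ F)) (h2.trans_le (shannonOR_le_orderRingHom φ G))⟩
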